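/- Let $(X,d)$ be a proper geodesic metric space that is Gromov hyperbolic (for some $\delta>0$, each side of every geodesic triangle lies in the $\delta$-neighbourhood of the union of the two other sides), and let $f\colon X\to X$ be non-expanding: $d(f(x),f(y))\le d(x,y)$ for all $x,y\in X$. Let $\partial_GX$ be the Gromov boundary (geodesic rays up to bounded distance); convergence of points of $X$ to a point of $\partial_GX$ is convergence in the Gromov compactification $X\sqcup\partial_GX$. For $\eta\in\partial_GX$ and $p\in X$ let $$\log\lambda_{\eta,p}(f):=\liminf_{z\to\eta}\bigl(d(z,p)-d(f(z),p)\bigr)\in(-\infty,+\infty].$$ The point $\eta$ is a boundary regular fixed point (BRFP) of $f$ if $\lambda_{\eta,p}(f)<+\infty$ (a condition that does not depend on $p$) and if $f(x_n)\to\eta$ for every sequence $x_n\to\eta$ that is contained in $\{x: d(x,\gamma)<R\}$ for some geodesic ray $\gamma$ with endpoint $\eta$ and some $R>0$. The stable dilation $\Lambda_\eta$ of $f$ at a BRFP $\eta$ is defined by $$\log\Lambda_\eta:=\lim_{n\to\infty}\frac{\log\lambda_{\eta,p}(f^n)}{n},$$ where the limit exists, is finite and does not depend on $p$. The BRFP $\eta$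 is repelling if $\Lambda_\eta>1$. A backward orbit is a sequence $(x_n)_{n\ge0}$ in $X$ with $f(x_{n+1})=x_n$ for all $n\ge0$; it has bounded step if $\sup_n d(x_n,x_{n+1})<+\infty$. For a backward orbit with bounded step put $\sigma_m(x_n):=\lim_{n\to\infty}d(x_{n+m},x_n)$ for $m\ge1$; its backward step rate is $b(x_n):=\lim_{m\to\infty}\sigma_m(x_n)/m$ (these limits exist and are finite). **Theorem.** Let $\eta\in\partial_GX$ be a repelling BRFP of $f$, with stable dilation $\Lambda_\eta>1$. Then: (i) there exists a backward orbit $(x_n)$ with bounded step that converges to $\eta$ and has backward step rate $b(x_n)=\log\Lambda_\eta$; (ii) if $(x_n)$ and $(y_n)$ are two backward orbits with bounded step converging to $\eta$, then $\sup_{n\ge0}d(x_n,y_n)<+\infty$; (iii) every backward orbit $(y_n)$ with bounded step converging to $\eta$ has backward step rate $b(y_n)=\log\Lambda_\eta$. -/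

import Mathlib

open Filter Topology Set
open scoped NNReal

/-! ### Geodesic spaces and Gromov hyperbolicity -/

/-- `S` is (the image of) a geodesic segment from `x` to `y`. -/
def IsGeodesicSegment {X : Type*} [MetricSpace X] (S : Set X) (x y : X) : Prop :=
  ∃ γ : ℝ → X, γ 0 = x ∧ γ (dist x y) = y ∧
    (∀ s ∈ Icc 0 (dist x y), ∀ t ∈ Icc 0 (dist x y), dist (γ s) (γ t) = |s - t|) ∧
    S = γ '' Icc 0 (dist x y)

/-- Any two points are joined by a geodesic segment. -/
def IsGeodesicSpace (X : Type*) [MetricSpace X] : Prop :=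
  ∀ x y : X, ∃ S : Set X, IsGeodesicSegment S x y

/-- Every geodesic triangle is `δ`-slim: each side is contained in the `δ`-neighbourhood of the
union of the two other sides. (The vertices are arbitrary, so that it is enough to consider one
side of each labelled triangle.) -/
def IsDeltaHyperbolic (X : Type*) [MetricSpace X] (δ : ℝ) : Prop :=
  ∀ (x y z : X) (S₁ S₂ S₃ : Set X),
    IsGeodesicSegment S₁ x y → IsGeodesicSegment S₂ y z → IsGeodesicSegment S₃ z x →
      ∀ u ∈ S₁, ∃ v ∈ S₂ ∪ S₃, dist u v < δ

/-- Gromov hyperbolicity. -/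
def IsGromovHyperbolic (X : Type*) [MetricSpace X] : Prop :=
  ∃ δ : ℝ, 0 < δ ∧ IsDeltaHyperbolic X δ

/-! ### The Gromov boundary and convergence to its points -/

/-- Geodesic rays, that is, isometric embeddings of `[0, +∞)`. -/
def GeodesicRay (X : Type*) [MetricSpace X] : Type _ :=
  {γ : ℝ≥0 → X // Isometry γ}

/-- Two geodesic rays are asymptotic if `sup_t d(γ(t), σ(t)) < +∞`. -/
def GeodesicRay.Asymptotic {X : Type*} [MetricSpace X] (γ σ : GeodesicRay X) : Prop :=
  ∃ C : ℝ, ∀ t : ℝ≥0, dist (γ.1 t) (σ.1 t) ≤ C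

/-- Being asymptotic is an equivalence relation. -/
def GeodesicRay.setoid (X : Type*) [MetricSpace X] : Setoid (GeodesicRay X) where
  r := GeodesicRay.Asymptotic
  iseqv :=
    { refl := fun γ => ⟨0, fun t => by simp⟩
      symm := fun ⟨C, hC⟩ => ⟨C, fun t => by rw [dist_comm]; exact hC t⟩
      trans := fun ⟨C, hC⟩ ⟨D, hD⟩ =>
        ⟨C + D, fun t => (dist_triangle _ _ _).trans (add_le_add (hC t) (hD t))⟩ }

/-- The Gromov boundary `∂_G X`: asymptoty classes of geodesic rays. -/
def GromovBoundary (X : Type*) [MetricSpace X] : Type _ :=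
  Quotient (GeodesicRay.setoid X)

/-- The endpoint `γ(+∞) ∈ ∂_G X` of a geodesic ray. -/
def GeodesicRay.endpoint {X : Type*} [MetricSpace X] (γ : GeodesicRay X) : GromovBoundary X :=
  Quotient.mk (GeodesicRay.setoid X) γ

/-- The Gromov product `(x, y)_p`. -/
noncomputable def gromovProduct {X : Type*} [MetricSpace X] (p x y : X) : ℝ :=
  (dist x p + dist y p - dist x y) / 2

/-- The trace on `X` of the filter of neighbourhoods of `η ∈ ∂_G X` in the Gromov compactification
`X ⊔ ∂_G X`: it is generated by the sets of points `x` such that `(x, γ(t))_p ≥ r` for all large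
`t`, where `γ` is a geodesic ray with endpoint `η`, and `r` is a real number. All choices of
the base point `p` and of the ray `γ` generate the same filter, since they change the Gromov
product by a bounded amount. -/
def GromovBoundary.nhds {X : Type*} [MetricSpace X] (η : GromovBoundary X) : Filter X :=
  ⨅ (p : X) (γ : GeodesicRay X) (_ : γ.endpoint = η) (r : ℝ),
    𝓟 {x : X | ∀ᶠ t in atTop, r ≤ gromovProduct p x (γ.1 t)}

/-! ### Dilation, boundary regular fixed points, stable dilation -/

/-- The geodesic region `A(γ, R)`, with vertex `γ(+∞)`. -/
def geodesicRegion {X : Type*} [MetricSpace X] (γ : GeodesicRay X) (R : ℝ) : Set X :=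
  {x | Metric.infDist x (range γ.1) < R}

/-- The self-map `f` has geodesic limit `ξ ∈ ∂_G X` at `η ∈ ∂_G X`. -/
def HasGeodesicLimit {X : Type*} [MetricSpace X] (f : X → X) (η ξ : GromovBoundary X) : Prop :=
  ∀ x : ℕ → X, Tendsto x atTop η.nhds →
    (∃ (γ : GeodesicRay X) (R : ℝ), γ.endpoint = η ∧ 0 < R ∧ ∀ n, x n ∈ geodesicRegion γ R) →
      Tendsto (fun n => f (x n)) atTop ξ.nhds

/-- The logarithm of the dilation of `f` at `η` with respect to the base point `p`,
`log λ_{η,p}(f) = liminf_{z → η} (d(z, p) - d(f(z), p))`, an extended real number. -/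
noncomputable def logDilation {X : Type*} [MetricSpace X] (f : X → X) (η : GromovBoundary X)
    (p : X) : EReal :=
  liminf (fun z : X => ((dist z p - dist (f z) p : ℝ) : EReal)) η.nhds

/-- `η` is a boundary regular fixed point of `f`: the dilation at `η` is finite (for one base point,
equivalently for all of them) and `f` has geodesic limit `η` at `η`. -/
def IsBRFP {X : Type*} [MetricSpace X] (f : X → X) (η : GromovBoundary X) : Prop :=
  (∃ p : X, logDilation f η p < ⊤) ∧ HasGeodesicLimit f η η

/-- The logarithm of the stable dilation, `log Λ_η = lim_n log λ_{η,p}(f^n) / n`, written as an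
upper limit so that the expression is meaningful before the limit is known to exist. -/
noncomputable def logStableDilation {X : Type*} [MetricSpace X] (f : X → X) (η : GromovBoundary X)
    (p : X) : EReal :=
  limsup (fun n : ℕ => logDilation f^[n] η p / (n : EReal)) atTop

/-! ### Backward orbits -/

/-- `f(x_n) = x_{n-1}` for all `n ≥ 1`. -/
def IsBackwardOrbit {X : Type*} (f : X → X) (x : ℕ → X) : Prop :=
  ∀ n, f (x (n + 1)) = x n

/-- The step `sup_n d(x_n, x_{n+1})` is finite. -/
def HasBoundedStep {X : Type*} [MetricSpace X] (x : ℕ → X) : Prop :=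
  ∃ C : ℝ, ∀ n, dist (x n) (x (n + 1)) ≤ C

/-- The limits `σ_m = lim_n d(x_{n+m}, x_n)` exist in `ℝ` for all `m`, and the backward step
rate `lim_m σ_m / m` exists and equals `b`. -/
def HasBackwardStepRate {X : Type*} [MetricSpace X] (x : ℕ → X) (b : ℝ) : Prop :=
  ∃ σ : ℕ → ℝ, (∀ m, Tendsto (fun n => dist (x (n + m)) (x n)) atTop (𝓝 (σ m))) ∧
    Tendsto (fun m : ℕ => σ m / (m : ℝ)) atTop (𝓝 b)

/-!
The four-point condition for Gromov products, which follows from slim triangles, carries the whole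
argument. Fix a geodesic ray `c` ending at `η`, and use `c 0` as the base point.

*Dilation.* For a non-expanding `F` the function `t - d(F(c t), c 0)` is nondecreasing, and its limit
is the logarithm of the dilation of `F` at `η`, up to an error depending only on the hyperbolicity
constant and on the base points (`GeodesicRay.le_logDilation`, `GeodesicRay.logDilation_le`). If `η`
is a boundary regular fixed point, then `f` moves the points of `c` by a bounded amount
(`IsBRFP.exists_dist_map_le`). Hence, high up on `c`, each iterate `f^n` is a translation, up to
an error independent of `n` (`IsRay.dist_map_sub_le`). The displacements are therefore additive up
to a bounded error, so they are `n L + O(1)`, and `L` is the logarithm of the stable dilation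
(`IsRay.exists_isQuasiTranslation`, `GeodesicRay.tendsto_logDilation_div`).

*Existence.* Let `L > 0` and let `m L` be large compared with the errors. The orbit of a high point
of `c` under `f^m` descends at a definite rate until it reaches a fixed height, and it stays close
to `c`, because a long move towards the origin preserves the bound on the distance to the ray
(`FourPoint.gromovProduct_step`, `IsRay.exists_descent`). The stopped orbits end in a fixed ball and their steps are uniformly
bounded, so that they subconverge to a backward orbit (`IsQuasiTranslation.exists_backwardOrbit`).

*Comparison.* A backward orbit with bounded step converging to `η` has a step rate, by monotonicity
and subadditivity, and this rate is positive. So a sparse subsequence of the orbit has long steps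
and little backtracking, and the local-to-global principle (`FourPoint.gromovProduct_le_of_local`)
keeps it close to `c` (`IsQuasiTranslation.exists_dist_height_le`). There `f^m` translates by
`m L + O(1)`, which gives the rate `L`; and two such orbits remain at bounded distance, since
points at the same height are close and `f` is non-expanding (`IsQuasiTranslation.exists_dist_le`).
-/

/-! ### The four-point condition -/

section GromovProduct

variable {X : Type*} [MetricSpace X]

/-- Gromov's four-point condition with constant `K`. -/
def FourPoint (X : Type*) [MetricSpace X] (K : ℝ) : Prop :=
  ∀ w x y z : X, min (gromovProduct w x y) (gromovProduct w y z) - K ≤ gromovProduct w x z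

lemma gromovProduct_comm (w x y : X) : gromovProduct w x y = gromovProduct w y x := by
  unfold gromovProduct
  rw [dist_comm x y]
  ring

lemma gromovProduct_self (w y : X) : gromovProduct w w y = 0 := by
  simp [gromovProduct, dist_comm]

lemma gromovProduct_self_right (w y : X) : gromovProduct w y w = 0 := by
  simp [gromovProduct]

lemma gromovProduct_nonneg (w x y : X) : 0 ≤ gromovProduct w x y := by
  have := dist_triangle_right x y w
  unfold gromovProduct
  linarith

lemma gromovProduct_le_dist (w x y : X) : gromovProduct w x y ≤ dist x w := by
  have := dist_triangle y x w
  rw [dist_comm y x] at this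
  unfold gromovProduct
  linarith

lemma gromovProduct_add_gromovProduct (w x y : X) :
    gromovProduct w x y + gromovProduct x w y = dist w x := by
  unfold gromovProduct
  rw [dist_comm x w, dist_comm y w, dist_comm y x]
  ring

lemma dist_eq_sub_gromovProduct (w x y : X) :
    dist x y = dist x w + dist y w - 2 * gromovProduct w x y := by
  unfold gromovProduct
  ring

lemma gromovProduct_le_add_dist_base (w w' x y : X) :
    gromovProduct w x y ≤ gromovProduct w' x y + dist w w' := by
  have h1 := dist_triangle x w' w
  have h2 := dist_triangle y w' w
  rw [dist_comm w' w] at h1 h2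
  unfold gromovProduct
  linarith

lemma gromovProduct_le_add_dist_right (w x y y' : X) :
    gromovProduct w x y ≤ gromovProduct w x y' + dist y y' := by
  have h1 := dist_triangle y y' w
  have h2 := dist_triangle x y y'
  unfold gromovProduct
  linarith

lemma gromovProduct_le_add_dist_left (w x x' y : X) :
    gromovProduct w x y ≤ gromovProduct w x' y + dist x x' := by
  rw [gromovProduct_comm w x, gromovProduct_comm w x']
  exact gromovProduct_le_add_dist_right w y x x'

lemma IsGeodesicSegment.gromovProduct_le_dist {S : Set X} {x y : X}
    (hS : IsGeodesicSegment S x y) (w : X) {u : X} (hu : u ∈ S) :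
    gromovProduct w x y ≤ dist u w := by
  obtain ⟨γ, h0, h1, hγ, rfl⟩ := hS
  obtain ⟨s, hs, rfl⟩ := hu
  have e1 := hγ 0 ⟨le_rfl, dist_nonneg⟩ s hs
  have e2 := hγ s hs (dist x y) ⟨dist_nonneg, le_rfl⟩
  rw [h0, zero_sub, abs_neg, abs_of_nonneg hs.1] at e1
  rw [h1, abs_sub_comm, abs_of_nonneg (by linarith [hs.2])] at e2
  have h3 := dist_triangle x (γ s) w
  have h4 := dist_triangle y (γ s) w
  rw [dist_comm y (γ s)] at h4
  unfold gromovProduct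
  linarith

lemma IsGeodesicSegment.dist_add_dist {S : Set X} {x y : X}
    (hS : IsGeodesicSegment S x y) {u : X} (hu : u ∈ S) :
    dist x u + dist u y = dist x y := by
  obtain ⟨γ, h0, h1, hγ, rfl⟩ := hS
  obtain ⟨s, hs, rfl⟩ := hu
  have e1 := hγ 0 ⟨le_rfl, dist_nonneg⟩ s hs
  have e2 := hγ s hs (dist x y) ⟨dist_nonneg, le_rfl⟩
  rw [h0, zero_sub, abs_neg, abs_of_nonneg hs.1] at e1
  rw [h1, abs_sub_comm, abs_of_nonneg (by linarith [hs.2])] at e2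
  linarith

lemma IsGeodesicSegment.left_mem {S : Set X} {x y : X} (hS : IsGeodesicSegment S x y) :
    x ∈ S := by
  obtain ⟨γ, h0, h1, hγ, rfl⟩ := hS
  exact ⟨0, ⟨le_rfl, dist_nonneg⟩, h0⟩

lemma IsGeodesicSegment.right_mem {S : Set X} {x y : X} (hS : IsGeodesicSegment S x y) :
    y ∈ S := by
  obtain ⟨γ, h0, h1, hγ, rfl⟩ := hS
  exact ⟨dist x y, ⟨dist_nonneg, le_rfl⟩, h1⟩

lemma IsGeodesicSegment.isPreconnected {S : Set X} {x y : X} (hS : IsGeodesicSegment S x y) :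
    IsPreconnected S := by
  obtain ⟨γ, h0, h1, hγ, rfl⟩ := hS
  refine isPreconnected_Icc.image γ ?_
  have : LipschitzOnWith 1 γ (Icc 0 (dist x y)) :=
    LipschitzOnWith.of_dist_le_mul fun s hs t ht => by
      rw [hγ s hs t ht, NNReal.coe_one, one_mul, Real.dist_eq]
  exact this.continuousOn

/-- In a slim triangle, some point of a side is close to both other sides; its distance to the
opposite vertex is then at most the Gromov product, up to a bounded error. -/
lemma IsDeltaHyperbolic.exists_mem_dist_le {δ : ℝ} (hδ : 0 < δ) (hyp : IsDeltaHyperbolic X δ)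
    (hgeo : IsGeodesicSpace X) {S : Set X} {x y : X} (hS : IsGeodesicSegment S x y) (w : X) :
    ∃ u ∈ S, dist u w ≤ gromovProduct w x y + 4 * δ := by
  obtain ⟨S₂, h₂⟩ := hgeo y w
  obtain ⟨S₃, h₃⟩ := hgeo w x
  have hcl : ∀ A : Set X, IsClosed {u : X | Metric.infDist u A ≤ δ} := fun A =>
    isClosed_le (Metric.continuous_infDist_pt A) continuous_const
  have hcov : S ⊆ {u | Metric.infDist u S₂ ≤ δ} ∪ {u | Metric.infDist u S₃ ≤ δ} := by
    intro u hu
    obtain ⟨v, hv | hv, huv⟩ := hyp x y w S S₂ S₃ hS h₂ h₃ u hu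
    · exact Or.inl ((Metric.infDist_le_dist_of_mem hv).trans huv.le)
    · exact Or.inr ((Metric.infDist_le_dist_of_mem hv).trans huv.le)
  obtain ⟨u, huS, hu2, hu3⟩ :=
    isPreconnected_closed_iff.1 hS.isPreconnected _ _ (hcl S₂) (hcl S₃) hcov
      ⟨y, hS.right_mem, by
        simpa [Metric.infDist_zero_of_mem h₂.left_mem] using hδ.le⟩
      ⟨x, hS.left_mem, by
        simpa [Metric.infDist_zero_of_mem h₃.right_mem] using hδ.le⟩
  obtain ⟨v, hv, huv⟩ := (Metric.infDist_lt_iff ⟨y, h₂.left_mem⟩).1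
    (lt_of_le_of_lt hu2 (by linarith : δ < 2 * δ))
  obtain ⟨v', hv', huv'⟩ := (Metric.infDist_lt_iff ⟨x, h₃.right_mem⟩).1
    (lt_of_le_of_lt hu3 (by linarith : δ < 2 * δ))
  refine ⟨u, huS, ?_⟩
  have e := hS.dist_add_dist huS
  have e2 := h₂.dist_add_dist hv
  have e3 := h₃.dist_add_dist hv'
  have t1 := dist_triangle u v w
  have t2 := dist_triangle u v y
  have t3 := dist_triangle u v' w
  have t4 := dist_triangle u v' x
  rw [dist_comm x u] at e
  rw [dist_comm y v] at e2
  rw [dist_comm w v', dist_comm w x] at e3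
  unfold gromovProduct
  linarith

lemma IsDeltaHyperbolic.fourPoint {δ : ℝ} (hδ : 0 < δ) (hyp : IsDeltaHyperbolic X δ)
    (hgeo : IsGeodesicSpace X) : FourPoint X (5 * δ) := by
  intro w x y z
  obtain ⟨S, hS⟩ := hgeo x z
  obtain ⟨S₂, h₂⟩ := hgeo z y
  obtain ⟨S₃, h₃⟩ := hgeo y x
  obtain ⟨u, hu, huw⟩ := hyp.exists_mem_dist_le hδ hgeo hS w
  obtain ⟨v, hv, huv⟩ := hyp x z y S S₂ S₃ hS h₂ h₃ u hu
  have hvw : dist v w ≤ dist u w + δ := by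
    have := dist_triangle v u w
    rw [dist_comm v u] at this
    linarith
  rcases hv with hv | hv
  · have := h₂.gromovProduct_le_dist w hv
    rw [gromovProduct_comm] at this
    have := min_le_right (gromovProduct w x y) (gromovProduct w y z)
    linarith
  · have := h₃.gromovProduct_le_dist w hv
    rw [gromovProduct_comm] at this
    have := min_le_left (gromovProduct w x y) (gromovProduct w y z)
    linarith

lemma FourPoint.nonneg {K : ℝ} (h4 : FourPoint X K) (x : X) : 0 ≤ K := by
  have := h4 x x x x
  simp only [gromovProduct_self, min_self] at this
  linarith

/-- In the four-point condition, the larger of the two products can be dropped from the minimum. -/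
lemma FourPoint.le_of_lt {K a : ℝ} (h4 : FourPoint X K) {w x y z : X}
    (hxz : gromovProduct w x z ≤ a) (hxy : a + K < gromovProduct w x y) :
    gromovProduct w y z ≤ a + K := by
  by_contra! h
  have := h4 w x y z
  have := lt_min hxy h
  linarith

lemma FourPoint.le_gromovProduct {K a : ℝ} (h4 : FourPoint X K) {w x y z : X}
    (hxy : a ≤ gromovProduct w x y) (hyz : a ≤ gromovProduct w y z) :
    a - K ≤ gromovProduct w x z := by
  have := h4 w x y z
  have := le_min hxy hyz
  linarith

/-- A step in the comparison of a broken path with a geodesic: if `x` is close to a geodesic from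
`o` to `w`, and `y` is obtained from `x` by a long move towards `w`, then `y` is close to a
geodesic from `o` to `w`, with the same bound. -/
lemma FourPoint.gromovProduct_step {K a : ℝ} (h4 : FourPoint X K) {o w x y : X}
    (hx : gromovProduct x o w ≤ a + K) (hy : gromovProduct y x w ≤ a)
    (hd : 2 * a + 3 * K < dist x y) : gromovProduct y o w ≤ a + K := by
  have hK := h4.nonneg o
  have e1 := gromovProduct_add_gromovProduct x y w
  have e2 := gromovProduct_add_gromovProduct x y o
  have h1 : gromovProduct x y o ≤ a + K + K := by
    refine h4.le_of_lt (x := w) (by rwa [gromovProduct_comm]) ?_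
    rw [gromovProduct_comm]
    linarith
  exact h4.le_of_lt (x := x) hy (by linarith)

/-- A sequence with long steps and little backtracking does not backtrack when it is compared
with a later point. -/
lemma FourPoint.gromovProduct_succ_le {K a : ℝ} (h4 : FourPoint X K) {z : ℕ → X} (ha : 0 ≤ a)
    (hz : ∀ k, gromovProduct (z (k + 1)) (z k) (z (k + 2)) ≤ a)
    (hd : ∀ k, 2 * a + 2 * K < dist (z k) (z (k + 1))) (j : ℕ) :
    ∀ k, gromovProduct (z (k + 1)) (z k) (z (k + 1 + j)) ≤ a + K := by
  induction j with
  | zero =>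
    intro k
    rw [add_zero, gromovProduct_self_right]
    linarith [h4.nonneg (z 0)]
  | succ j ih =>
    intro k
    have h1 := ih (k + 1)
    have e := gromovProduct_add_gromovProduct (z (k + 1)) (z (k + 2)) (z (k + 2 + j))
    have h2 := hd (k + 1)
    rw [show k + 1 + (j + 1) = k + 2 + j by ring]
    rw [gromovProduct_comm]
    simp only [show k + 1 + 1 = k + 2 by ring] at h1 h2
    have h3 := h4.le_of_lt (x := z (k + 2)) (y := z (k + 2 + j)) (z := z k) (w := z (k + 1))
      (a := a) (by rw [gromovProduct_comm]; exact hz k) (by linarith)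
    exact h3

/-- Local-to-global principle: the points of a sequence with long steps and little backtracking
stay close to the geodesics between earlier and later points. -/
lemma FourPoint.gromovProduct_le_of_local {K a : ℝ} (h4 : FourPoint X K) {z : ℕ → X} (ha : 0 ≤ a)
    (hz : ∀ k, gromovProduct (z (k + 1)) (z k) (z (k + 2)) ≤ a)
    (hd : ∀ k, 2 * a + 5 * K < dist (z k) (z (k + 1))) (k j : ℕ) :
    gromovProduct (z k) (z 0) (z (k + j)) ≤ a + 2 * K := by
  have hK := h4.nonneg (z 0)
  have main : ∀ i ≤ k, gromovProduct (z i) (z 0) (z (k + j)) ≤ a + K + K := by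
    intro i
    induction i with
    | zero =>
      intro _
      rw [gromovProduct_self]
      linarith
    | succ i ih =>
      intro hi
      refine h4.gromovProduct_step (ih (by omega)) ?_ (by linarith [hd i])
      have := h4.gromovProduct_succ_le ha hz (fun k => by linarith [hd k]) (k + j - (i + 1)) i
      rwa [show i + 1 + (k + j - (i + 1)) = k + j by omega] at this
  linarith [main k le_rfl]

end GromovProduct

/-! ### Geodesic rays and convergence to their endpoints -/

section Ray

variable {X : Type*} [MetricSpace X] {c : ℝ → X} {K : ℝ}

/-- `c` restricts to a geodesic ray on `[0, +∞)`; the values at negative times are irrelevant. Real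
parameters make it possible to subtract times. -/
def IsRay (c : ℝ → X) : Prop :=
  ∀ s t : ℝ, 0 ≤ s → 0 ≤ t → dist (c s) (c t) = |s - t|

/-- `u` converges along `l` to the endpoint of the ray `c`, expressed by Gromov products based at
the origin of the ray. -/
def TendsToEnd {ι : Type*} (c : ℝ → X) (u : ι → X) (l : Filter ι) : Prop :=
  ∀ r : ℝ, ∀ᶠ i in l, ∀ᶠ t in atTop, r ≤ gromovProduct (c 0) (u i) (c t)

lemma IsRay.dist_zero (hc : IsRay c) {t : ℝ} (ht : 0 ≤ t) : dist (c t) (c 0) = t := by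
  rw [hc t 0 ht le_rfl, sub_zero, abs_of_nonneg ht]

lemma IsRay.gromovProduct_eq (hc : IsRay c) {s t : ℝ} (hs : 0 ≤ s) (hst : s ≤ t) :
    gromovProduct (c 0) (c s) (c t) = s := by
  unfold gromovProduct
  rw [hc.dist_zero hs, hc.dist_zero (hs.trans hst), hc s t hs (hs.trans hst), abs_sub_comm,
    abs_of_nonneg (by linarith)]
  ring

lemma IsRay.gromovProduct_eq' (hc : IsRay c) {s t : ℝ} (hs : 0 ≤ s) (hst : s ≤ t) :
    gromovProduct (c 0) (c t) (c s) = s := by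
  rw [gromovProduct_comm, hc.gromovProduct_eq hs hst]

/-- A point with large Gromov product with a point of the ray is close to that point, up to the
excess of its distance from the origin. -/
lemma IsRay.dist_eq (hc : IsRay c) (x : X) {t : ℝ} (ht : 0 ≤ t) :
    dist x (c t) = dist x (c 0) + t - 2 * gromovProduct (c 0) x (c t) := by
  rw [dist_eq_sub_gromovProduct (c 0), hc.dist_zero ht]

lemma IsRay.le_gromovProduct_of_eventually (hc : IsRay c) (h4 : FourPoint X K) {x : X} {a s : ℝ}
    (hs : 0 ≤ s) (has : a ≤ s) (h : ∀ᶠ t in atTop, a ≤ gromovProduct (c 0) x (c t)) :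
    a - K ≤ gromovProduct (c 0) x (c s) := by
  obtain ⟨t, ht, hst⟩ := (h.and (eventually_ge_atTop s)).exists
  exact h4.le_gromovProduct ht (by rwa [hc.gromovProduct_eq' hs hst])

lemma TendsToEnd.eventually_le {ι : Type*} {u : ι → X} {l : Filter ι} (hu : TendsToEnd c u l)
    (hc : IsRay c) (h4 : FourPoint X K) {s : ℝ} (hs : 0 ≤ s) :
    ∀ᶠ i in l, s - K ≤ gromovProduct (c 0) (u i) (c s) :=
  (hu s).mono fun _ hi => hc.le_gromovProduct_of_eventually h4 hs le_rfl hi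

lemma TendsToEnd.eventually_le_dist {ι : Type*} {u : ι → X} {l : Filter ι}
    (hu : TendsToEnd c u l) (r : ℝ) : ∀ᶠ i in l, r ≤ dist (u i) (c 0) :=
  (hu r).mono fun _ hi =>
    let ⟨_, ht⟩ := hi.exists
    ht.trans (gromovProduct_le_dist _ _ _)

lemma IsRay.tendsToEnd_of_dist_le {ι : Type*} {l : Filter ι} (hc : IsRay c) {u : ι → X}
    {τ : ι → ℝ} (hτ : Tendsto τ l atTop) {D : ℝ} (hD : ∀ i, 0 ≤ τ i → dist (u i) (c (τ i)) ≤ D) :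
    TendsToEnd c u l := by
  intro r
  filter_upwards [hτ.eventually_ge_atTop (r + D), hτ.eventually_ge_atTop 0] with i hi hi0
  filter_upwards [eventually_ge_atTop (τ i)] with t ht
  have h1 := gromovProduct_le_add_dist_left (c 0) (c (τ i)) (u i) (c t)
  rw [hc.gromovProduct_eq hi0 ht, dist_comm] at h1
  linarith [hD i hi0]

/-- A geodesic ray with real parameters, constant at negative times. -/
def GeodesicRay.toReal (γ : GeodesicRay X) (t : ℝ) : X := γ.1 t.toNNReal

lemma GeodesicRay.isRay (γ : GeodesicRay X) : IsRay γ.toReal := by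
  intro s t hs ht
  unfold GeodesicRay.toReal
  rw [γ.2.dist_eq, NNReal.dist_eq, Real.coe_toNNReal s hs, Real.coe_toNNReal t ht]

lemma GeodesicRay.eventually_toReal_iff (γ : GeodesicRay X) (P : X → Prop) :
    (∀ᶠ t in atTop, P (γ.toReal t)) ↔ ∀ᶠ t in atTop, P (γ.1 t) := by
  constructor
  · intro h
    have := NNReal.tendsto_coe_atTop.2 tendsto_id |>.eventually h
    simpa [GeodesicRay.toReal] using this
  · intro h
    exact Real.tendsto_toNNReal_atTop.eventually h

/-- Convergence to a boundary point can be tested with one ray and with its origin as the base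
point. -/
lemma GeodesicRay.tendsto_nhds_iff {ι : Type*} (γ : GeodesicRay X) {u : ι → X} {l : Filter ι} :
    Tendsto u l γ.endpoint.nhds ↔ TendsToEnd γ.toReal u l := by
  simp only [GromovBoundary.nhds, tendsto_iInf, tendsto_principal, mem_ofPred_eq]
  constructor
  · intro h r
    refine (h (γ.toReal 0) γ rfl r).mono fun i hi => ?_
    exact (γ.eventually_toReal_iff fun y => r ≤ gromovProduct (γ.toReal 0) (u i) y).2 hi
  · intro h q σ hσ r
    -- A change of the base point and of the ray alters Gromov products by a bounded amount.
    obtain ⟨C, hC⟩ : σ.Asymptotic γ := Quotient.exact hσ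
    refine (h (r + C + dist (γ.toReal 0) q)).mono fun i hi => ?_
    have hi := (γ.eventually_toReal_iff fun y =>
      r + C + dist (γ.toReal 0) q ≤ gromovProduct (γ.toReal 0) (u i) y).1 hi
    refine hi.mono fun t ht => ?_
    have h1 := gromovProduct_le_add_dist_base (γ.toReal 0) q (u i) (γ.1 t)
    have h2 := gromovProduct_le_add_dist_right q (u i) (γ.1 t) (σ.1 t)
    rw [dist_comm (γ.1 t)] at h2
    linarith [hC t]

lemma GeodesicRay.tendsto_toReal (γ : GeodesicRay X) :
    Tendsto γ.toReal atTop γ.endpoint.nhds :=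
  γ.tendsto_nhds_iff.2 <| γ.isRay.tendsToEnd_of_dist_le tendsto_id (D := 0) (by simp)

end Ray

/-! ### The dilation along a ray -/

section Dilation

variable {X : Type*} [MetricSpace X] {c : ℝ → X} {K : ℝ} {F : X → X}

lemma dist_iterate_le {f : X → X} (hf : ∀ x y, dist (f x) (f y) ≤ dist x y) (n : ℕ) (x y : X) :
    dist (f^[n] x) (f^[n] y) ≤ dist x y := by
  induction n with
  | zero => simp
  | succ n ih =>
    rw [Function.iterate_succ_apply', Function.iterate_succ_apply']
    exact (hf _ _).trans ih

lemma IsRay.sub_dist_mono (hc : IsRay c) (hF : ∀ x y, dist (F x) (F y) ≤ dist x y) {s t : ℝ}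
    (hs : 0 ≤ s) (hst : s ≤ t) : s - dist (F (c s)) (c 0) ≤ t - dist (F (c t)) (c 0) := by
  have h1 := hF (c t) (c s)
  rw [hc t s (hs.trans hst) hs, abs_of_nonneg (by linarith)] at h1
  have := dist_triangle (F (c t)) (F (c s)) (c 0)
  linarith

/-- The dilation is bounded below by the displacements along a ray: a point `z` near `η` is almost
on a geodesic through `c t`, so `F` cannot bring `z` much closer to the base point than `c t`. -/
lemma GeodesicRay.le_logDilation (γ : GeodesicRay X) (h4 : FourPoint X K)
    (hF : ∀ x y, dist (F x) (F y) ≤ dist x y) (q : X) {t : ℝ} (ht : 0 ≤ t) :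
    ((t - dist (F (γ.toReal t)) (γ.toReal 0) - 2 * K - 2 * dist (γ.toReal 0) q : ℝ) : EReal) ≤
      logDilation F γ.endpoint q := by
  refine le_liminf_of_le (by isBoundedDefault) ?_
  have h := ((γ.tendsto_nhds_iff (u := id)).1 tendsto_id).eventually_le γ.isRay h4 ht
  filter_upwards [h] with z hz
  rw [EReal.coe_le_coe_iff]
  have e := γ.isRay.dist_eq z ht
  have h1 := hF z (γ.toReal t)
  have h2 := dist_triangle4 (F z) (F (γ.toReal t)) (γ.toReal 0) q
  have h3 := dist_triangle_right z (γ.toReal 0) q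
  simp only [id_eq] at hz
  linarith

lemma GeodesicRay.logDilation_le (γ : GeodesicRay X) (q : X) {α : ℝ}
    (hα : ∀ t, 0 ≤ t → t - dist (F (γ.toReal t)) (γ.toReal 0) ≤ α) :
    logDilation F γ.endpoint q ≤ ((α + 2 * dist (γ.toReal 0) q : ℝ) : EReal) := by
  unfold logDilation
  refine (liminf_le_liminf_of_le γ.tendsto_toReal (by isBoundedDefault)
    (by isBoundedDefault)).trans ?_
  refine liminf_le_of_frequently_le' (Eventually.frequently ?_)
  rw [eventually_map]
  filter_upwards [eventually_ge_atTop 0] with t ht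
  rw [EReal.coe_le_coe_iff]
  have h1 := hα t ht
  have h2 := dist_triangle (γ.toReal t) (γ.toReal 0) q
  have h3 := dist_triangle_right (F (γ.toReal t)) (γ.toReal 0) q
  rw [γ.isRay.dist_zero ht] at h2
  linarith

/-- If `F` has finite dilation at the endpoint of the ray and fixes this endpoint, the image of a
point of the ray lies in the direction of the endpoint, at least up to the expected height. -/
lemma IsRay.eventually_le_gromovProduct_map (hc : IsRay c) (h4 : FourPoint X K)
    (hF : ∀ x y, dist (F x) (F y) ≤ dist x y)
    (hlim : TendsToEnd c (fun n : ℕ => F (c n)) atTop) {α : ℝ}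
    (hα : ∀ t, 0 ≤ t → t - dist (F (c t)) (c 0) ≤ α) {t : ℝ} (ht : 0 ≤ t) :
    ∀ᶠ u in atTop, t - α - K ≤ gromovProduct (c 0) (F (c t)) (c u) := by
  obtain ⟨n, hn, htn⟩ := ((hlim (t - α)).and
    (tendsto_natCast_atTop_atTop.eventually_ge_atTop t)).exists
  have hn0 := ht.trans htn
  have h1 : t - α ≤ gromovProduct (c 0) (F (c t)) (F (c n)) := by
    have h1 := hF (c t) (c n)
    rw [hc t n ht hn0, abs_sub_comm, abs_of_nonneg (by linarith)] at h1
    have h2 := hα t ht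
    have h3 := hα n hn0
    unfold gromovProduct
    linarith
  filter_upwards [hn] with u hu
  exact h4.le_gromovProduct h1 hu

lemma IsRay.dist_map_self_le (hc : IsRay c) (h4 : FourPoint X K)
    (hF : ∀ x y, dist (F x) (F y) ≤ dist x y)
    (hlim : TendsToEnd c (fun n : ℕ => F (c n)) atTop) {α : ℝ} (hα0 : 0 ≤ α)
    (hα : ∀ t, 0 ≤ t → t - dist (F (c t)) (c 0) ≤ α) {t : ℝ} (ht : 0 ≤ t) :
    dist (F (c t)) (c t) ≤ dist (F (c 0)) (c 0) + 2 * α + 4 * K := by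
  have hK := h4.nonneg (c 0)
  have h1 := hc.le_gromovProduct_of_eventually h4 ht (by linarith)
    (hc.eventually_le_gromovProduct_map h4 hF hlim hα ht)
  have h2 := hc.sub_dist_mono hF le_rfl ht
  linarith [hc.dist_eq (F (c t)) ht]

/-- High up on the ray, a map with dilation `α` is a translation by `α`, up to an error that
depends on the space alone. -/
lemma IsRay.dist_map_sub_le (hc : IsRay c) (h4 : FourPoint X K)
    (hF : ∀ x y, dist (F x) (F y) ≤ dist x y)
    (hlim : TendsToEnd c (fun n : ℕ => F (c n)) atTop) {α : ℝ}
    (hα : ∀ t, 0 ≤ t → t - dist (F (c t)) (c 0) ≤ α) {t : ℝ} (ht : 0 ≤ t) (htα : α ≤ t)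
    (hαt : α - 1 ≤ t - dist (F (c t)) (c 0)) :
    dist (F (c t)) (c (t - α)) ≤ 1 + 4 * K := by
  have hK := h4.nonneg (c 0)
  have h1 := hc.le_gromovProduct_of_eventually h4 (sub_nonneg.2 htα) (by linarith)
    (hc.eventually_le_gromovProduct_map h4 hF hlim hα ht)
  linarith [hc.dist_eq (F (c t)) (sub_nonneg.2 htα)]

end Dilation

/-! ### Iterates along the ray -/

section Iterates

variable {X : Type*} [MetricSpace X] {c : ℝ → X} {K : ℝ} {f : X → X}

/-- High up on the ray `c`, each iterate `f^n` is a translation by `n L` towards the origin, up to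
an error `C` independent of `n`. -/
def IsQuasiTranslation (f : X → X) (c : ℝ → X) (L C : ℝ) : Prop :=
  ∀ n : ℕ, ∃ T : ℝ, 0 ≤ T ∧ n * L ≤ T ∧
    ∀ t, T ≤ t → dist (f^[n] (c t)) (c (t - n * L)) ≤ C

/-- The asymptotic displacement `lim_t (t - d(F(c(t)), c(0)))`, which is the logarithm of the
dilation up to a bounded error, written as a supremum. -/
noncomputable def rayDilation (F : X → X) (c : ℝ → X) : ℝ :=
  ⨆ t : ℝ≥0, ((t : ℝ) - dist (F (c t)) (c 0))

lemma dist_iterate_ray_le (hf : ∀ x y, dist (f x) (f y) ≤ dist x y) {D : ℝ}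
    (hD : ∀ t, 0 ≤ t → dist (f (c t)) (c t) ≤ D) (n : ℕ) {t : ℝ} (ht : 0 ≤ t) :
    dist (f^[n] (c t)) (c t) ≤ n * D := by
  induction n with
  | zero => simp
  | succ n ih =>
    have h1 := dist_triangle (f^[n + 1] (c t)) (f^[n] (c t)) (c t)
    have h2 := dist_iterate_le hf n (f (c t)) (c t)
    rw [← Function.iterate_succ_apply] at h2
    push_cast
    linarith [hD t ht]

lemma IsRay.sub_dist_iterate_le (hc : IsRay c) (hf : ∀ x y, dist (f x) (f y) ≤ dist x y) {D : ℝ}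
    (hD : ∀ t, 0 ≤ t → dist (f (c t)) (c t) ≤ D) (n : ℕ) {t : ℝ} (ht : 0 ≤ t) :
    t - dist (f^[n] (c t)) (c 0) ≤ n * D := by
  have h1 := dist_iterate_ray_le hf hD n ht
  have h2 := dist_triangle_left (c t) (c 0) (f^[n] (c t))
  rw [hc.dist_zero ht] at h2
  linarith

lemma IsRay.bddAbove_iterate (hc : IsRay c) (hf : ∀ x y, dist (f x) (f y) ≤ dist x y) {D : ℝ}
    (hD : ∀ t, 0 ≤ t → dist (f (c t)) (c t) ≤ D) (n : ℕ) :
    BddAbove (range fun t : ℝ≥0 => (t : ℝ) - dist (f^[n] (c t)) (c 0)) :=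
  ⟨n * D, by rintro _ ⟨t, rfl⟩; exact hc.sub_dist_iterate_le hf hD n t.2⟩

lemma IsRay.sub_dist_le_rayDilation (hc : IsRay c) (hf : ∀ x y, dist (f x) (f y) ≤ dist x y)
    {D : ℝ} (hD : ∀ t, 0 ≤ t → dist (f (c t)) (c t) ≤ D) (n : ℕ) {t : ℝ} (ht : 0 ≤ t) :
    t - dist (f^[n] (c t)) (c 0) ≤ rayDilation f^[n] c :=
  le_ciSup (hc.bddAbove_iterate hf hD n) (⟨t, ht⟩ : ℝ≥0)

lemma IsRay.exists_rayDilation_sub_le (hc : IsRay c) (hf : ∀ x y, dist (f x) (f y) ≤ dist x y)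
    (n : ℕ) {ε : ℝ} (hε : 0 < ε) :
    ∃ T : ℝ, 0 ≤ T ∧ ∀ t, T ≤ t → rayDilation f^[n] c - ε ≤ t - dist (f^[n] (c t)) (c 0) := by
  obtain ⟨T, hT⟩ := exists_lt_of_lt_ciSup
    (show rayDilation f^[n] c - ε < rayDilation f^[n] c by linarith)
  exact ⟨T, T.2, fun t ht => hT.le.trans (hc.sub_dist_mono (dist_iterate_le hf n) T.2 ht)⟩

lemma IsRay.abs_rayDilation_le (hc : IsRay c) (hf : ∀ x y, dist (f x) (f y) ≤ dist x y) {D : ℝ}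
    (hD : ∀ t, 0 ≤ t → dist (f (c t)) (c t) ≤ D) (n : ℕ) : |rayDilation f^[n] c| ≤ n * D := by
  refine abs_le.2 ⟨?_, ciSup_le fun t => hc.sub_dist_iterate_le hf hD n t.2⟩
  have h1 := hc.sub_dist_le_rayDilation hf hD n le_rfl
  linarith [dist_iterate_ray_le hf hD n le_rfl]

lemma IsRay.exists_dist_iterate_sub_rayDilation_le (hc : IsRay c) (h4 : FourPoint X K)
    (hf : ∀ x y, dist (f x) (f y) ≤ dist x y) {D : ℝ}
    (hD : ∀ t, 0 ≤ t → dist (f (c t)) (c t) ≤ D) (n : ℕ) :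
    ∃ T : ℝ, 0 ≤ T ∧ rayDilation f^[n] c ≤ T ∧
      ∀ t, T ≤ t → dist (f^[n] (c t)) (c (t - rayDilation f^[n] c)) ≤ 1 + 4 * K := by
  obtain ⟨T, hT0, hT⟩ := hc.exists_rayDilation_sub_le hf n one_pos
  refine ⟨max T (rayDilation f^[n] c), hT0.trans (le_max_left _ _), le_max_right _ _,
    fun t ht => ?_⟩
  have h1 := (le_max_left _ _).trans ht
  have h2 := (le_max_right _ _).trans ht
  refine hc.dist_map_sub_le h4 (dist_iterate_le hf n) ?_
    (fun s hs => hc.sub_dist_le_rayDilation hf hD n hs) (hT0.trans h1) h2 (hT t h1)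
  exact hc.tendsToEnd_of_dist_le tendsto_natCast_atTop_atTop
    fun k hk => dist_iterate_ray_le hf hD n hk

/-- The displacements of the iterates are additive up to a bounded error. -/
lemma IsRay.abs_rayDilation_add_sub_le (hc : IsRay c) (h4 : FourPoint X K)
    (hf : ∀ x y, dist (f x) (f y) ≤ dist x y) {D : ℝ}
    (hD : ∀ t, 0 ≤ t → dist (f (c t)) (c t) ≤ D) (m n : ℕ) :
    |rayDilation f^[m + n] c - (rayDilation f^[m] c + rayDilation f^[n] c)| ≤ 3 * (1 + 4 * K) := by
  obtain ⟨T₁, h10, h11, h1⟩ := hc.exists_dist_iterate_sub_rayDilation_le h4 hf hD n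
  obtain ⟨T₂, h20, h21, h2⟩ := hc.exists_dist_iterate_sub_rayDilation_le h4 hf hD m
  obtain ⟨T₃, h30, h31, h3⟩ := hc.exists_dist_iterate_sub_rayDilation_le h4 hf hD (m + n)
  set a := rayDilation f^[m] c
  set b := rayDilation f^[n] c
  set d := rayDilation f^[m + n] c
  obtain ⟨t, ht1, ht2, ht3⟩ : ∃ t : ℝ, T₁ ≤ t ∧ T₂ + b ≤ t ∧ T₃ ≤ t :=
    ⟨max T₁ (max (T₂ + b) T₃), by simp, by simp, by simp⟩
  have e1 := h1 t ht1
  have e2 := h2 (t - b) (by linarith)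
  have e3 := h3 t ht3
  have e4 := dist_iterate_le hf m (f^[n] (c t)) (c (t - b))
  rw [← Function.iterate_add_apply] at e4
  have e5 := dist_triangle_left (c (t - d)) (c (t - b - a)) (f^[m + n] (c t))
  have e6 := dist_triangle (f^[m + n] (c t)) (f^[m] (c (t - b))) (c (t - b - a))
  rw [hc _ _ (by linarith) (by linarith)] at e5
  rw [abs_sub_comm, show a + b - d = t - d - (t - b - a) by ring]
  linarith

/-- Homogenization of a sequence that is additive up to a bounded error. -/
lemma exists_tendsto_div_of_abs_add_sub_le {u : ℕ → ℝ} {E D : ℝ}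
    (hu : ∀ m n, |u (m + n) - (u m + u n)| ≤ E) (hD : ∀ n : ℕ, |u n| ≤ n * D) :
    ∃ L : ℝ, Tendsto (fun n : ℕ => u n / n) atTop (𝓝 L) ∧ ∀ n : ℕ, |u n - n * L| ≤ E := by
  have hE : 0 ≤ E := (abs_nonneg _).trans (hu 0 0)
  have hE' : Tendsto (fun n : ℕ => E / n) atTop (𝓝 0) := tendsto_const_div_atTop_nhds_zero_nat E
  have hDn : ∀ n : ℕ, 0 ≤ D * n := fun n => by
    have := (abs_nonneg _).trans (hD n); linarith
  have key : ∀ v : ℕ → ℝ, (∀ m n, |v (m + n) - (v m + v n)| ≤ E) → (∀ n : ℕ, |v n| ≤ n * D) →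
      ∃ L : ℝ, Tendsto (fun n : ℕ => v n / n) atTop (𝓝 L) ∧ ∀ n : ℕ, n * L ≤ v n + E := by
    intro v hv hvD
    have hsub : Subadditive fun n => v n + E := fun m n => by
      have := (abs_le.1 (hv m n)).2
      linarith
    have hbdd : BddBelow (range fun n : ℕ => (v n + E) / n) := by
      refine ⟨-D, ?_⟩
      rintro _ ⟨n, rfl⟩
      rcases Nat.eq_zero_or_pos n with rfl | hn
      · have := (abs_nonneg _).trans (hvD 1)
        simp only [Nat.cast_one, one_mul] at this
        simpa using this
      · have hn' : (0 : ℝ) < n := by exact_mod_cast hn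
        simp only
        rw [le_div_iff₀ hn']
        have := (abs_le.1 (hvD n)).1
        linarith
    refine ⟨hsub.lim, ?_, fun n => ?_⟩
    · have := (hsub.tendsto_lim hbdd).sub hE'
      rw [sub_zero] at this
      refine this.congr fun n => ?_
      ring
    · rcases Nat.eq_zero_or_pos n with rfl | hn
      · have h0 := abs_le.1 (hvD 0)
        simp only [Nat.cast_zero, zero_mul, neg_zero] at h0 ⊢
        linarith [h0.1]
      · have hn' : (0 : ℝ) < n := by exact_mod_cast hn
        have := hsub.lim_le_div hbdd hn.ne'
        rw [le_div_iff₀ hn'] at this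
        linarith
  obtain ⟨L, hL, hLu⟩ := key u hu hD
  obtain ⟨L', hL', hLu'⟩ := key (fun n => -u n)
    (fun m n => by
      rw [show -u (m + n) - (-u m + -u n) = -(u (m + n) - (u m + u n)) by ring, abs_neg]
      exact hu m n)
    (fun n => by rw [abs_neg]; exact hD n)
  have : L' = -L := by
    refine tendsto_nhds_unique hL' (hL.neg.congr fun n => ?_)
    ring
  subst this
  refine ⟨L, hL, fun n => abs_le.2 ⟨?_, ?_⟩⟩
  · linarith [hLu n]
  · linarith [hLu' n]

/-- The stable displacement `L` of `f` along the ray. -/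
lemma IsRay.exists_isQuasiTranslation (hc : IsRay c) (h4 : FourPoint X K)
    (hf : ∀ x y, dist (f x) (f y) ≤ dist x y) {D : ℝ}
    (hD : ∀ t, 0 ≤ t → dist (f (c t)) (c t) ≤ D) :
    ∃ L C : ℝ, Tendsto (fun n : ℕ => rayDilation f^[n] c / n) atTop (𝓝 L) ∧
      IsQuasiTranslation f c L C := by
  obtain ⟨L, hL, hLn⟩ := exists_tendsto_div_of_abs_add_sub_le
    (hc.abs_rayDilation_add_sub_le h4 hf hD) (hc.abs_rayDilation_le hf hD)
  refine ⟨L, 1 + 4 * K + 3 * (1 + 4 * K), hL, fun n => ?_⟩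
  obtain ⟨T, hT0, hT1, hT⟩ := hc.exists_dist_iterate_sub_rayDilation_le h4 hf hD n
  refine ⟨max T (n * L), hT0.trans (le_max_left _ _), le_max_right _ _, fun t ht => ?_⟩
  have h1 := (le_max_left _ _).trans ht
  have h2 := (le_max_right _ _).trans ht
  have h3 := hT t h1
  have h4 := dist_triangle (f^[n] (c t)) (c (t - rayDilation f^[n] c)) (c (t - n * L))
  rw [hc (t - rayDilation f^[n] c) (t - n * L) (by linarith) (by linarith),
    show t - rayDilation f^[n] c - (t - n * L) = -(rayDilation f^[n] c - n * L) by ring,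
    abs_neg] at h4
  linarith [hLn n]

/-- The dilation of an iterate at the endpoint agrees with the displacement along the ray up to a
bounded error, so both have the same growth rate. -/
lemma GeodesicRay.tendsto_logDilation_div (γ : GeodesicRay X) (h4 : FourPoint X K)
    (hf : ∀ x y, dist (f x) (f y) ≤ dist x y) {D L : ℝ}
    (hD : ∀ t, 0 ≤ t → dist (f (γ.toReal t)) (γ.toReal t) ≤ D)
    (hL : Tendsto (fun n : ℕ => rayDilation f^[n] γ.toReal / n) atTop (𝓝 L)) (q : X) :
    Tendsto (fun n : ℕ => logDilation f^[n] γ.endpoint q / (n : EReal)) atTop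
      (𝓝 (L : EReal)) := by
  set E := 1 + 2 * K + 2 * dist (γ.toReal 0) q with hE
  have hK := h4.nonneg q
  have hlow : ∀ n, ((rayDilation f^[n] γ.toReal - E : ℝ) : EReal) ≤
      logDilation f^[n] γ.endpoint q := by
    intro n
    obtain ⟨T, hT0, hT⟩ := γ.isRay.exists_rayDilation_sub_le hf n one_pos
    refine le_trans ?_ (γ.le_logDilation h4 (dist_iterate_le hf n) q hT0)
    rw [EReal.coe_le_coe_iff]
    linarith [hT T le_rfl]
  have hupp : ∀ n, logDilation f^[n] γ.endpoint q ≤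
      ((rayDilation f^[n] γ.toReal + E : ℝ) : EReal) := by
    intro n
    refine (γ.logDilation_le q fun t ht =>
      γ.isRay.sub_dist_le_rayDilation hf hD n ht).trans ?_
    rw [EReal.coe_le_coe_iff]
    linarith
  have hE' : Tendsto (fun n : ℕ => E / n) atTop (𝓝 0) := tendsto_const_div_atTop_nhds_zero_nat E
  have t1 : Tendsto (fun n : ℕ => (rayDilation f^[n] γ.toReal - E) / (n : ℝ)) atTop (𝓝 L) := by
    have := hL.sub hE'
    rw [sub_zero] at this
    exact this.congr fun n => by ring
  have t2 : Tendsto (fun n : ℕ => (rayDilation f^[n] γ.toReal + E) / (n : ℝ)) atTop (𝓝 L) := by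
    have := hL.add hE'
    rw [add_zero] at this
    exact this.congr fun n => by ring
  refine tendsto_of_tendsto_of_tendsto_of_le_of_le
    ((continuous_coe_real_ereal.tendsto L).comp t1)
    ((continuous_coe_real_ereal.tendsto L).comp t2) (fun n => ?_) (fun n => ?_)
  · simp only [Function.comp_apply, EReal.coe_div, EReal.coe_natCast]
    exact EReal.div_le_div_right_of_nonneg (by exact_mod_cast Nat.zero_le n) (hlow n)
  · simp only [Function.comp_apply, EReal.coe_div, EReal.coe_natCast]
    exact EReal.div_le_div_right_of_nonneg (by exact_mod_cast Nat.zero_le n) (hupp n)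

/-- A boundary regular fixed point is fixed by `f` in a strong sense: `f` moves the points of a ray
ending there by a bounded amount. -/
lemma IsBRFP.exists_dist_map_le (γ : GeodesicRay X) (h4 : FourPoint X K)
    (hf : ∀ x y, dist (f x) (f y) ≤ dist x y) (hη : IsBRFP f γ.endpoint) :
    ∃ D : ℝ, ∀ t, 0 ≤ t → dist (f (γ.toReal t)) (γ.toReal t) ≤ D := by
  obtain ⟨⟨q, hq⟩, hlim⟩ := hη
  obtain ⟨a, ha⟩ : ∃ a : ℝ, logDilation f γ.endpoint q ≤ a := by
    obtain ⟨a, ha, -⟩ := EReal.lt_iff_exists_real_btwn.1 hq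
    exact ⟨a, ha.le⟩
  have hα : ∀ t, 0 ≤ t → t - dist (f (γ.toReal t)) (γ.toReal 0) ≤
      max 0 (a + 2 * K + 2 * dist (γ.toReal 0) q) := by
    intro t ht
    have := (γ.le_logDilation h4 hf q ht).trans ha
    rw [EReal.coe_le_coe_iff] at this
    exact le_max_of_le_right (by linarith)
  have hend : TendsToEnd γ.toReal (fun n : ℕ => f (γ.toReal n)) atTop := by
    refine γ.tendsto_nhds_iff.1 (hlim (fun n : ℕ => γ.toReal n)
      (γ.tendsto_toReal.comp tendsto_natCast_atTop_atTop) ⟨γ, 1, rfl, one_pos, fun n => ?_⟩)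
    have hmem : γ.toReal n ∈ range γ.1 := ⟨_, rfl⟩
    simp [geodesicRegion, Metric.infDist_zero_of_mem hmem]
  exact ⟨_, fun t ht => γ.isRay.dist_map_self_le h4 hf hend (le_max_left _ _) hα ht⟩

end Iterates

/-! ### Quasi-translations of the ray -/

section QuasiTranslation

variable {X : Type*} [MetricSpace X] {c : ℝ → X} {K : ℝ} {f : X → X}

/-- A point `x` behind `c T`, as seen from the origin, is brought closer to the origin by a map
which translates `c T` by `ℓ`. -/
lemma IsRay.dist_map_le_sub (hc : IsRay c) {g : X → X} (hg : ∀ x y, dist (g x) (g y) ≤ dist x y)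
    {T ℓ C : ℝ} (hT0 : 0 ≤ T) (hℓT : ℓ ≤ T) (hT : dist (g (c T)) (c (T - ℓ)) ≤ C) {x : X}
    (hx : T - K ≤ gromovProduct (c 0) x (c T)) :
    dist (g x) (c 0) ≤ dist x (c 0) - (ℓ - C - 2 * K) := by
  have h1 := dist_triangle4 (g x) (g (c T)) (c (T - ℓ)) (c 0)
  rw [hc.dist_zero (sub_nonneg.2 hℓT)] at h1
  linarith [hg x (c T), hc.dist_eq x hT0]

/-- As long as the orbit of a point `c t` under a long quasi-translation has not come down to a
given height, it descends at a definite rate, and it stays close to the ray. -/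
lemma IsRay.descent_step (hc : IsRay c) (h4 : FourPoint X K) {g : X → X}
    (hg : ∀ x y, dist (g x) (g y) ≤ dist x y) {T ℓ C : ℝ} (hT0 : 0 ≤ T) (hℓT : ℓ ≤ T)
    (hT : ∀ t, T ≤ t → dist (g (c t)) (c (t - ℓ)) ≤ C) (hℓ : 3 * C + 7 * K < ℓ) {t : ℝ}
    (ht : T ≤ t) {k : ℕ} (hk : T + (C + K + K) ≤ dist (g^[k] (c t)) (c 0))
    (hgp : gromovProduct (g^[k] (c t)) (c t) (c 0) ≤ C + K + K) :
    gromovProduct (g^[k + 1] (c t)) (c t) (c 0) ≤ C + K + K ∧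
      dist (g^[k + 1] (c t)) (c 0) ≤ dist (g^[k] (c t)) (c 0) - (ℓ - C - 2 * K) := by
  have hK := h4.nonneg (c 0)
  have hC := dist_nonneg.trans (hT T le_rfl)
  have e1 := gromovProduct_add_gromovProduct (c 0) (g^[k] (c t)) (c t)
  rw [gromovProduct_comm] at hgp
  rw [dist_comm (c 0)] at e1
  have h1 : T - K ≤ gromovProduct (c 0) (g^[k] (c t)) (c T) :=
    h4.le_gromovProduct (y := c t) (by linarith) (hc.gromovProduct_eq' hT0 ht).ge
  have h2 := hc.dist_map_le_sub hg hT0 hℓT (hT T le_rfl) h1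
  rw [← Function.iterate_succ_apply' g] at h2
  have h3 : dist (g^[k] (c t)) (g^[k + 1] (c t)) ≤ ℓ + C := by
    rw [Function.iterate_succ_apply]
    refine (dist_iterate_le hg k _ _).trans ?_
    have h5 := dist_triangle_right (c t) (g (c t)) (c (t - ℓ))
    rw [hc t (t - ℓ) (by linarith) (by linarith), sub_sub_cancel, abs_of_nonneg (by linarith)]
      at h5
    linarith [hT t ht]
  have h6 := dist_triangle (g^[k] (c t)) (g^[k + 1] (c t)) (c 0)
  refine ⟨?_, h2⟩
  refine h4.gromovProduct_step (x := g^[k] (c t)) (a := C + K) ?_ ?_ ?_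
  · rwa [gromovProduct_comm]
  · unfold gromovProduct
    rw [dist_comm (c 0)]
    linarith
  · linarith

/-- The orbit of `c t` comes down to a fixed height at some time `κ`; read backwards from that time,
it stays close to the ray and goes up at a definite rate, uniformly in `t`. -/
lemma IsRay.exists_descent (hc : IsRay c) (h4 : FourPoint X K) {g : X → X}
    (hg : ∀ x y, dist (g x) (g y) ≤ dist x y) {T ℓ C : ℝ} (hT0 : 0 ≤ T) (hℓT : ℓ ≤ T)
    (hT : ∀ t, T ≤ t → dist (g (c t)) (c (t - ℓ)) ≤ C) (hℓ : 3 * C + 7 * K < ℓ) {t : ℝ}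
    (ht : T ≤ t) :
    ∃ κ : ℕ, dist (g^[κ] (c t)) (c 0) ≤ T + (C + K + K) ∧ ∀ j ≤ κ,
      gromovProduct (g^[κ - j] (c t)) (c t) (c 0) ≤ C + K + K ∧
      j * (ℓ - C - 2 * K) ≤ dist (g^[κ - j] (c t)) (c 0) := by
  classical
  have hK := h4.nonneg (c 0)
  have hC := dist_nonneg.trans (hT T le_rfl)
  have hθ : 0 < ℓ - C - 2 * K := by linarith
  have inv : ∀ k, (∀ j < k, T + (C + K + K) ≤ dist (g^[j] (c t)) (c 0)) →
      gromovProduct (g^[k] (c t)) (c t) (c 0) ≤ C + K + K := by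
    intro k
    induction k with
    | zero =>
      intro _
      rw [Function.iterate_zero_apply, gromovProduct_self]
      linarith
    | succ k ih =>
      intro h
      exact (hc.descent_step h4 hg hT0 hℓT hT hℓ ht (h k k.lt_succ_self)
        (ih fun j hj => h j (hj.trans k.lt_succ_self))).1
  have hex : ∃ k, dist (g^[k] (c t)) (c 0) < T + (C + K + K) := by
    by_contra! h
    have hdec : ∀ k : ℕ, dist (g^[k] (c t)) (c 0) ≤ t - k * (ℓ - C - 2 * K) := by
      intro k
      induction k with
      | zero => simp [hc.dist_zero (hT0.trans ht)]
      | succ k ih =>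
        have := (hc.descent_step h4 hg hT0 hℓT hT hℓ ht (h k) (inv k fun j _ => h j)).2
        push_cast
        linarith
    obtain ⟨k, hk⟩ := exists_nat_gt (t / (ℓ - C - 2 * K))
    rw [div_lt_iff₀ hθ] at hk
    linarith [hdec k, dist_nonneg (x := g^[k] (c t)) (y := c 0)]
  have hmin : ∀ j < Nat.find hex, T + (C + K + K) ≤ dist (g^[j] (c t)) (c 0) := fun j hj =>
    not_lt.1 (Nat.find_min hex hj)
  refine ⟨Nat.find hex, (Nat.find_spec hex).le, fun j hj =>
    ⟨inv _ fun i hi => hmin i (by omega), ?_⟩⟩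
  induction j with
  | zero => simp
  | succ j ih =>
    have h1 := ih (by omega)
    have h2 := (hc.descent_step h4 hg hT0 hℓT hT hℓ ht
      (hmin (Nat.find hex - (j + 1)) (by omega)) (inv _ fun i hi => hmin i (by omega))).2
    rw [show Nat.find hex - (j + 1) + 1 = Nat.find hex - j by omega] at h2
    push_cast
    linarith

end QuasiTranslation

/-! ### Backward orbits -/

section BackwardOrbit

lemma IsBackwardOrbit.iterate_apply {α : Type*} {f : α → α} {y : ℕ → α}
    (hy : IsBackwardOrbit f y) (k n : ℕ) : f^[k] (y (n + k)) = y n := by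
  induction k with
  | zero => rfl
  | succ k ih => rw [Function.iterate_succ_apply, ← add_assoc, hy, ih]

variable {X : Type*} [MetricSpace X] {c : ℝ → X} {K : ℝ} {f : X → X}

lemma dist_add_le_of_step {y : ℕ → X} {S : ℝ} (hS : ∀ n, dist (y n) (y (n + 1)) ≤ S) (n k : ℕ) :
    dist (y n) (y (n + k)) ≤ k * S := by
  induction k with
  | zero => simp
  | succ k ih =>
    have := dist_triangle (y n) (y (n + k)) (y (n + k + 1))
    push_cast
    rw [← add_assoc]
    linarith [hS (n + k)]

/-- Finite pieces of backward orbits which end in a compact set subconverge to a backward orbit. -/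
lemma exists_isBackwardOrbit_of_approx [ProperSpace X] (hf : Continuous f) {y : ℕ → ℕ → X} {p : X}
    {r : ℕ → ℝ} (hy : ∀ n, ∀ᶠ N in atTop, f (y N (n + 1)) = y N n)
    (hr : ∀ n, ∀ᶠ N in atTop, dist (y N n) p ≤ r n) :
    ∃ (U : Ultrafilter ℕ) (z : ℕ → X), (U : Filter ℕ) ≤ atTop ∧
      (∀ n, Tendsto (fun N => y N n) U (𝓝 (z n))) ∧ IsBackwardOrbit f z := by
  set U : Ultrafilter ℕ := Ultrafilter.of atTop
  have hU : (U : Filter ℕ) ≤ atTop := Ultrafilter.of_le atTop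
  have hlim : ∀ n, ∃ a, Tendsto (fun N => y N n) U (𝓝 a) := by
    intro n
    obtain ⟨a, -, ha⟩ := (isCompact_closedBall p (r n)).ultrafilter_le_nhds
      (U.map fun N => y N n) (by
        rw [le_principal_iff]
        exact hU (hr n))
    exact ⟨a, ha⟩
  choose z hz using hlim
  refine ⟨U, z, hU, hz, fun n => ?_⟩
  exact tendsto_nhds_unique_of_eventuallyEq ((hf.tendsto _).comp (hz (n + 1))) (hz n) (hU (hy n))

lemma IsQuasiTranslation.exists_backwardOrbit [ProperSpace X] {L C D : ℝ}
    (hQ : IsQuasiTranslation f c L C) (hL : 0 < L) (hc : IsRay c) (h4 : FourPoint X K)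
    (hf : ∀ x y, dist (f x) (f y) ≤ dist x y)
    (hD : ∀ t, 0 ≤ t → dist (f (c t)) (c t) ≤ D) :
    ∃ x : ℕ → X, IsBackwardOrbit f x ∧ HasBoundedStep x ∧ TendsToEnd c x atTop := by
  have hcont : Continuous f := (LipschitzWith.mk_one hf).continuous
  have hK := h4.nonneg (c 0)
  have hD0 := dist_nonneg.trans (hD 0 le_rfl)
  -- The translation length `m * L` has to dominate the errors, which do not depend on `m`.
  obtain ⟨m, hm⟩ := exists_nat_gt ((3 * C + 7 * K) / L)
  rw [div_lt_iff₀ hL] at hm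
  obtain ⟨T, hT0, hmT, hT⟩ := hQ m
  have hC := dist_nonneg.trans (hT T le_rfl)
  have hm0 : 0 < m := by
    rcases Nat.eq_zero_or_pos m with rfl | h
    · simp only [Nat.cast_zero, zero_mul] at hm
      linarith
    · exact h
  set R := C + K + K with hR
  set θ := m * L - C - 2 * K with hθ
  have hθ0 : 0 < θ := by linarith
  have hdesc : ∀ N : ℕ, ∃ κ : ℕ, T ≤ N → dist ((f^[m])^[κ] (c N)) (c 0) ≤ T + R ∧ ∀ j ≤ κ,
      gromovProduct ((f^[m])^[κ - j] (c N)) (c N) (c 0) ≤ R ∧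
      j * θ ≤ dist ((f^[m])^[κ - j] (c N)) (c 0) := by
    intro N
    by_cases hN : T ≤ N
    · obtain ⟨κ, hκ⟩ := hc.exists_descent h4 (dist_iterate_le hf m) hT0 hmT hT hm hN
      exact ⟨κ, fun _ => hκ⟩
    · exact ⟨0, fun h => absurd h hN⟩
  choose κ hκ using hdesc
  have hTN : ∀ a : ℝ, ∀ᶠ N : ℕ in atTop, a ≤ (N : ℝ) := fun a =>
    tendsto_natCast_atTop_atTop.eventually_ge_atTop a
  -- The time needed for the descent is unbounded, since the steps are at most `D`.
  have hlong : ∀ n : ℕ, ∀ᶠ N in atTop, n ≤ m * κ N := by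
    intro n
    filter_upwards [hTN T, hTN (T + R + (n + 1) * D + 1)] with N h1 h2
    have h3 := (hκ N h1).1
    rw [← Function.iterate_mul] at h3
    have h5 := dist_iterate_ray_le hf hD (m * κ N) (hT0.trans h1)
    have h6 := dist_triangle_left (c N) (c 0) (f^[m * κ N] (c N))
    rw [hc.dist_zero (hT0.trans h1)] at h6
    by_contra! h
    have h7 : ((m * κ N : ℕ) : ℝ) ≤ n := by exact_mod_cast h.le
    have h8 := mul_le_mul_of_nonneg_right h7 hD0
    linarith
  obtain ⟨U, z, hU, hz, hzf⟩ := exists_isBackwardOrbit_of_approx hcont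
    (y := fun N n => f^[m * κ N - n] (c N)) (p := c 0) (r := fun n => n * D + (T + R))
    (fun n => by
      filter_upwards [hlong (n + 1)] with N hN
      rw [← Function.iterate_succ_apply' f, show (m * κ N - (n + 1)).succ = m * κ N - n by omega])
    (fun n => by
      filter_upwards [hlong n, hTN T] with N hN h1
      have h3 := (hκ N h1).1
      rw [← Function.iterate_mul] at h3
      have h5 := dist_iterate_le hf (m * κ N - n) (f^[n] (c N)) (c N)
      rw [← Function.iterate_add_apply, Nat.sub_add_cancel hN] at h5
      have h6 := dist_iterate_ray_le hf hD n (hT0.trans h1)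
      have h7 := dist_triangle_left (f^[m * κ N - n] (c N)) (c 0) (f^[m * κ N] (c N))
      linarith)
  have hstep : ∀ n, dist (z n) (z (n + 1)) ≤ D := by
    intro n
    refine le_of_tendsto ((hz n).dist (hz (n + 1))) (hU ?_)
    filter_upwards [hlong (n + 1), hTN T] with N hN h1
    have h5 := dist_iterate_le hf (m * κ N - (n + 1)) (f (c N)) (c N)
    rw [← Function.iterate_succ_apply,
      show (m * κ N - (n + 1)).succ = m * κ N - n by omega] at h5
    exact h5.trans (hD _ (hT0.trans h1))
  have hgp : ∀ (j : ℕ) (u : ℝ), j * θ ≤ u →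
      j * θ - R - K ≤ gromovProduct (c 0) (z (m * j)) (c u) := by
    intro j u hu
    have hu0 : 0 ≤ u := le_trans (by positivity) hu
    have hcontgp : Continuous fun x => gromovProduct (c 0) x (c u) := by
      unfold gromovProduct
      fun_prop
    refine ge_of_tendsto ((hcontgp.tendsto _).comp (hz (m * j))) (hU ?_)
    filter_upwards [hlong (m * j), hTN T, hTN u] with N hN h1 h2
    obtain ⟨h3, h5⟩ := (hκ N h1).2 j (Nat.le_of_mul_le_mul_left hN hm0)
    rw [← Function.iterate_mul, Nat.mul_sub] at h3 h5
    have e := gromovProduct_add_gromovProduct (c 0) (f^[m * κ N - m * j] (c N)) (c N)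
    rw [gromovProduct_comm] at h3
    rw [dist_comm (c 0)] at e
    refine h4.le_gromovProduct (y := c N) ?_ ?_
    · linarith
    · rw [hc.gromovProduct_eq' hu0 h2]
      linarith
  refine ⟨z, hzf, ⟨D, hstep⟩, fun r => ?_⟩
  have hdiv : Tendsto (fun n : ℕ => ((n / m : ℕ) : ℝ) * θ) atTop atTop :=
    (tendsto_natCast_atTop_atTop.comp (Nat.tendsto_div_const_atTop hm0.ne')).atTop_mul_const hθ0
  filter_upwards [hdiv.eventually_ge_atTop (r + R + K + m * D)] with n hn
  filter_upwards [eventually_ge_atTop (((n / m : ℕ) : ℝ) * θ)] with u hu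
  have h1 := hgp (n / m) u hu
  have h2 := gromovProduct_le_add_dist_left (c 0) (z (m * (n / m))) (z n) (c u)
  have h3 := dist_add_le_of_step hstep (m * (n / m)) (n % m)
  rw [Nat.div_add_mod] at h3
  have h5 : ((n % m : ℕ) : ℝ) ≤ m := by exact_mod_cast (Nat.mod_lt n hm0).le
  have h6 := mul_le_mul_of_nonneg_right h5 hD0
  linarith

/-- The step rate exists because the distances `d(x_{n+m}, x_n)` are nondecreasing in `n`, and
their limits are subadditive in `m`. -/
lemma IsBackwardOrbit.exists_stepRate {y : ℕ → X} (hy : IsBackwardOrbit f y)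
    (hf : ∀ x y, dist (f x) (f y) ≤ dist x y) {S : ℝ} (hS : ∀ n, dist (y n) (y (n + 1)) ≤ S) :
    ∃ (σ : ℕ → ℝ) (b : ℝ), (∀ m, Tendsto (fun n => dist (y (n + m)) (y n)) atTop (𝓝 (σ m))) ∧
      (∀ m n, dist (y (n + m)) (y n) ≤ σ m) ∧ (∀ m : ℕ, m * b ≤ σ m) ∧
      Tendsto (fun m : ℕ => σ m / m) atTop (𝓝 b) := by
  have hmono : ∀ m, Monotone fun n => dist (y (n + m)) (y n) := fun m =>
    monotone_nat_of_le_succ fun n => by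
      have := hf (y (n + m + 1)) (y (n + 1))
      rw [hy, hy] at this
      rwa [show n + 1 + m = n + m + 1 by ring]
  have hbdd : ∀ m, BddAbove (range fun n => dist (y (n + m)) (y n)) := fun m =>
    ⟨m * S, by
      rintro _ ⟨n, rfl⟩
      simp only
      rw [dist_comm]
      exact dist_add_le_of_step hS n m⟩
  set σ : ℕ → ℝ := fun m => ⨆ n, dist (y (n + m)) (y n)
  have hle : ∀ m n, dist (y (n + m)) (y n) ≤ σ m := fun m n => le_ciSup (hbdd m) n
  have hσ0 : ∀ m, 0 ≤ σ m := fun m => dist_nonneg.trans (hle m 0)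
  have hsub : Subadditive σ := fun m k => ciSup_le fun n => by
    have h1 := dist_triangle (y (n + (m + k))) (y (n + m)) (y n)
    have h2 := hle k (n + m)
    rw [add_assoc] at h2
    linarith [hle m n]
  have hbelow : BddBelow (range fun m : ℕ => σ m / m) :=
    ⟨0, by rintro _ ⟨m, rfl⟩; exact div_nonneg (hσ0 m) (Nat.cast_nonneg m)⟩
  refine ⟨σ, hsub.lim, fun m => tendsto_atTop_ciSup (hmono m) (hbdd m), hle, fun m => ?_,
    hsub.tendsto_lim hbelow⟩
  rcases Nat.eq_zero_or_pos m with rfl | hm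
  · simpa using hσ0 0
  · have := hsub.lim_le_div hbelow hm.ne'
    rwa [le_div_iff₀ (by exact_mod_cast hm), mul_comm] at this

lemma IsRay.dist_height_le (hc : IsRay c) {x : X} {s R : ℝ} (hs : 0 ≤ s)
    (hx : dist x (c s) ≤ R) : dist x (c (dist x (c 0))) ≤ 2 * R := by
  have h1 := abs_dist_sub_le x (c s) (c 0)
  rw [hc.dist_zero hs] at h1
  have h2 := dist_triangle x (c s) (c (dist x (c 0)))
  rw [hc s _ hs dist_nonneg, abs_sub_comm] at h2
  linarith

/-- A point that is close to geodesics from `o` to points converging to the endpoint of the ray `c`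
is close to `c`. -/
lemma IsRay.dist_height_le_of_tendsToEnd (hc : IsRay c) (h4 : FourPoint X K) {ι : Type*}
    {l : Filter ι} [NeBot l] {w : ι → X} (hw : TendsToEnd c w l) {o z : X} {A : ℝ}
    (hA : ∀ᶠ i in l, gromovProduct z o (w i) ≤ A) :
    dist z (c (dist z (c 0))) ≤ 2 * (A + K + dist (c 0) o) + 2 * K := by
  have hK := h4.nonneg o
  obtain ⟨i, hi, hiA⟩ := ((hw (A + K + 1 + dist (c 0) z)).and hA).exists
  have hA0 := (gromovProduct_nonneg z o (w i)).trans hiA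
  have h1 : ∀ᶠ u in atTop,
      dist z (c 0) - (A + K + dist (c 0) o) ≤ gromovProduct (c 0) z (c u) := by
    filter_upwards [hi] with u hu
    have h2 := gromovProduct_le_add_dist_base (c 0) z (w i) (c u)
    have h3 : gromovProduct z (c u) o ≤ A + K :=
      h4.le_of_lt (x := w i) (by rwa [gromovProduct_comm]) (by linarith)
    have h5 := gromovProduct_le_add_dist_left z (c 0) o (c u)
    have e := gromovProduct_add_gromovProduct (c 0) z (c u)
    rw [gromovProduct_comm z (c u)] at h3
    rw [dist_comm (c 0) z] at e
    linarith
  have hd : 0 ≤ dist (c 0) o := dist_nonneg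
  have h2 := hc.le_gromovProduct_of_eventually h4 (dist_nonneg (x := z) (y := c 0))
    (by linarith) h1
  linarith [hc.dist_eq z (dist_nonneg (x := z) (y := c 0))]

/-- The step rate of a backward orbit is positive, since the orbit moves towards the origin of the
ray under `f`. -/
lemma IsQuasiTranslation.stepRate_pos {L C : ℝ} (hQ : IsQuasiTranslation f c L C) (hL : 0 < L)
    (hc : IsRay c) (h4 : FourPoint X K) (hf : ∀ x y, dist (f x) (f y) ≤ dist x y) {y : ℕ → X}
    (hy : IsBackwardOrbit f y) (hend : TendsToEnd c y atTop) {σ : ℕ → ℝ} {b : ℝ}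
    (hσ : ∀ m n, dist (y (n + m)) (y n) ≤ σ m)
    (hb : Tendsto (fun m : ℕ => σ m / m) atTop (𝓝 b)) : 0 < b := by
  have hK := h4.nonneg (c 0)
  obtain ⟨m, hm⟩ := exists_nat_gt ((C + 2 * K) / L)
  rw [div_lt_iff₀ hL] at hm
  obtain ⟨T, hT0, hmT, hT⟩ := hQ m
  have hC := dist_nonneg.trans (hT T le_rfl)
  have hm0 : 0 < m := by
    rcases Nat.eq_zero_or_pos m with rfl | h
    · simp only [Nat.cast_zero, zero_mul] at hm
      linarith
    · exact h
  set θ := m * L - C - 2 * K with hθ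
  have hθ0 : 0 < θ := by linarith
  obtain ⟨n₀, hn₀⟩ := eventually_atTop.1 (hend.eventually_le hc h4 hT0)
  have hdec : ∀ k : ℕ, k * θ + dist (y n₀) (c 0) ≤ dist (y (n₀ + k * m)) (c 0) := by
    intro k
    induction k with
    | zero => simp
    | succ k ih =>
      have := hc.dist_map_le_sub (dist_iterate_le hf m) hT0 hmT (hT T le_rfl)
        (hn₀ (n₀ + k * m + m) (by omega))
      rw [hy.iterate_apply] at this
      rw [show n₀ + (k + 1) * m = n₀ + k * m + m by ring]
      push_cast
      linarith
  have hm0' : (0 : ℝ) < m := by exact_mod_cast hm0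
  have hlow : θ / m ≤ b := by
    refine ge_of_tendsto (hb.comp (tendsto_id.atTop_mul_const' hm0)) ?_
    filter_upwards [eventually_gt_atTop 0] with k hk
    have hk' : (0 : ℝ) < k := by exact_mod_cast hk
    simp only [Function.comp_apply, id_eq]
    push_cast
    rw [div_le_div_iff₀ hm0' (by positivity)]
    have h1 := dist_triangle (y (n₀ + k * m)) (y n₀) (c 0)
    have h2 : k * θ ≤ σ (k * m) := by linarith [hdec k, hσ (k * m) n₀]
    nlinarith
  exact (div_pos hθ0 hm0').trans_le hlow

/-- A backward orbit with bounded step converging to the endpoint of the ray stays close to the ray.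
For a large `M` the displacement over `2 M` steps is almost twice the displacement over `M` steps,
so `y (n + k M)` is a sequence with long steps and little backtracking, and the local-to-global
principle applies. -/
lemma IsQuasiTranslation.exists_dist_height_le {L C : ℝ} (hQ : IsQuasiTranslation f c L C)
    (hL : 0 < L) (hc : IsRay c) (h4 : FourPoint X K) (hf : ∀ x y, dist (f x) (f y) ≤ dist x y)
    {y : ℕ → X} (hy : IsBackwardOrbit f y) (hstep : HasBoundedStep y)
    (hend : TendsToEnd c y atTop) : ∃ R : ℝ, ∀ n, dist (y n) (c (dist (y n) (c 0))) ≤ R := by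
  obtain ⟨S, hS⟩ := hstep
  have hK := h4.nonneg (c 0)
  have hS0 := dist_nonneg.trans (hS 0)
  obtain ⟨σ, b, hlim, hle, hbσ, hb⟩ := hy.exists_stepRate hf hS
  have hb0 := hQ.stepRate_pos hL hc h4 hf hy hend hle hb
  obtain ⟨M, hM1, hM2, hM0⟩ : ∃ M : ℕ, σ M / M ≤ b * (11 / 10) ∧
      2 * (2 + 5 * K) < M * b ∧ 0 < M := by
    have e1 := hb.eventually_le_const (show b < b * (11 / 10) by linarith)
    have e2 := (tendsto_natCast_atTop_atTop.atTop_mul_const hb0).eventually_gt_atTop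
      (2 * (2 + 5 * K))
    obtain ⟨M, h⟩ := (e1.and (e2.and (eventually_gt_atTop 0))).exists
    exact ⟨M, h.1, h.2.1, h.2.2⟩
  rw [div_le_iff₀ (by exact_mod_cast hM0)] at hM1
  obtain ⟨n₁, hn₁⟩ := eventually_atTop.1
    (((hlim M).eventually_const_le (show σ M - 1 < σ M by linarith)).and
    ((hlim (2 * M)).eventually_const_le (show σ (2 * M) - 1 < σ (2 * M) by linarith)))
  -- `a` bounds the backtracking, as `σ (2 * M) ≥ 2 * M * b`; the choice of `M` makes it a small
  -- fraction of the step length. The summand `1 / 2` is due to the limits defining `σ`.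
  set a := σ M - M * b + 1 / 2 with ha
  have ha0 : 0 ≤ a := by linarith [hbσ M]
  have hsucc : ∀ k, n₁ + (k + 1) * M = n₁ + k * M + M := fun k => by ring
  have hsucc2 : ∀ k, n₁ + (k + 2) * M = n₁ + k * M + 2 * M := fun k => by ring
  have hloc : ∀ k, gromovProduct (y (n₁ + (k + 1) * M)) (y (n₁ + k * M)) (y (n₁ + (k + 2) * M)) ≤
      a := by
    intro k
    have h1 := hle M (n₁ + k * M)
    have h2 := hle M (n₁ + (k + 1) * M)
    have h3 := (hn₁ (n₁ + k * M) (by omega)).2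
    have h5 := hbσ (2 * M)
    rw [← hsucc] at h1
    rw [← hsucc, show k + 1 + 1 = k + 2 by ring] at h2
    rw [← hsucc2] at h3
    push_cast at h5
    unfold gromovProduct
    rw [dist_comm (y (n₁ + k * M)), dist_comm (y (n₁ + k * M))]
    linarith
  have hlong : ∀ k, 2 * a + 5 * K < dist (y (n₁ + k * M)) (y (n₁ + (k + 1) * M)) := by
    intro k
    have h1 := (hn₁ (n₁ + k * M) (by omega)).1
    rw [dist_comm, hsucc]
    linarith [hbσ M]
  have hsub : Tendsto (fun k => n₁ + k * M) atTop atTop :=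
    tendsto_atTop_mono (fun k => (Nat.le_mul_of_pos_right k hM0).trans (Nat.le_add_left _ _))
      tendsto_id
  have hnear : ∀ k, dist (y (n₁ + k * M)) (c (dist (y (n₁ + k * M)) (c 0))) ≤
      2 * (a + 2 * K + K + dist (c 0) (y (n₁ + 0 * M))) + 2 * K := by
    intro k
    refine hc.dist_height_le_of_tendsToEnd h4 (l := atTop) (w := fun j => y (n₁ + j * M))
      (fun r => hsub.eventually (hend r)) ?_
    filter_upwards [eventually_ge_atTop k] with j hj
    have := h4.gromovProduct_le_of_local (z := fun k => y (n₁ + k * M)) ha0 hloc hlong k (j - k)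
    rwa [Nat.add_sub_cancel' hj] at this
  set B := 2 * (a + 2 * K + K + dist (c 0) (y (n₁ + 0 * M))) + 2 * K
  refine ⟨2 * ((n₁ + M) * S + B), fun n => ?_⟩
  obtain ⟨k, hk⟩ : ∃ k, dist (y n) (y (n₁ + k * M)) ≤ (n₁ + M) * S := by
    rcases le_total n n₁ with h | h
    · refine ⟨0, ?_⟩
      have h1 := dist_add_le_of_step hS n (n₁ - n)
      rw [Nat.add_sub_cancel' h] at h1
      have h2 : ((n₁ - n : ℕ) : ℝ) ≤ n₁ + M := by exact_mod_cast (by omega : n₁ - n ≤ n₁ + M)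
      rw [zero_mul, add_zero]
      exact h1.trans (mul_le_mul_of_nonneg_right h2 hS0)
    · refine ⟨(n - n₁) / M, ?_⟩
      have h1 := dist_add_le_of_step hS (n₁ + (n - n₁) / M * M) ((n - n₁) % M)
      rw [add_assoc, Nat.div_add_mod', Nat.add_sub_cancel' h] at h1
      have h3 := Nat.mod_lt (n - n₁) hM0
      have h2 : (((n - n₁) % M : ℕ) : ℝ) ≤ n₁ + M := by
        exact_mod_cast (by omega : (n - n₁) % M ≤ n₁ + M)
      rw [dist_comm]
      exact h1.trans (mul_le_mul_of_nonneg_right h2 hS0)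
  refine hc.dist_height_le (s := dist (y (n₁ + k * M)) (c 0)) dist_nonneg ?_
  exact (dist_triangle _ _ _).trans (add_le_add hk (hnear k))

lemma IsQuasiTranslation.hasBackwardStepRate {L C : ℝ} (hQ : IsQuasiTranslation f c L C)
    (hL : 0 < L) (hc : IsRay c) (h4 : FourPoint X K) (hf : ∀ x y, dist (f x) (f y) ≤ dist x y)
    {y : ℕ → X} (hy : IsBackwardOrbit f y) (hstep : HasBoundedStep y)
    (hend : TendsToEnd c y atTop) : HasBackwardStepRate y L := by
  obtain ⟨R, hR⟩ := hQ.exists_dist_height_le hL hc h4 hf hy hstep hend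
  obtain ⟨S, hS⟩ := hstep
  obtain ⟨σ, b, hlim, -, -, -⟩ := hy.exists_stepRate hf hS
  refine ⟨σ, hlim, ?_⟩
  have key : ∀ m : ℕ, |σ m - m * L| ≤ 2 * R + C := by
    intro m
    obtain ⟨T, hT0, hmT, hT⟩ := hQ m
    refine le_of_tendsto ((hlim m).sub_const (m * L)).abs ?_
    have hev := (tendsto_add_atTop_nat m).eventually (hend.eventually_le_dist T)
    filter_upwards [hev] with n hn
    set s := dist (y (n + m)) (c 0)
    have h1 := hT s hn
    have h2 := dist_iterate_le hf m (y (n + m)) (c s)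
    rw [hy.iterate_apply] at h2
    have h3 := dist_triangle (y n) (f^[m] (c s)) (c (s - m * L))
    have h5 := hR (n + m)
    have h6 : dist (c s) (c (s - m * L)) = m * L := by
      rw [hc _ _ dist_nonneg (by linarith), sub_sub_cancel, abs_of_nonneg (by positivity)]
    have h7 := dist_triangle4 (y (n + m)) (c s) (c (s - m * L)) (y n)
    have h8 := dist_triangle4 (c s) (y (n + m)) (y n) (c (s - m * L))
    rw [dist_comm (c s) (y (n + m))] at h8
    rw [dist_comm (c (s - m * L)) (y n)] at h7
    rw [abs_le]
    constructor <;> linarith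
  have hE : Tendsto (fun m : ℕ => L + (2 * R + C) / m) atTop (𝓝 L) := by
    simpa using (tendsto_const_div_atTop_nhds_zero_nat (2 * R + C)).const_add L
  have hE' : Tendsto (fun m : ℕ => L - (2 * R + C) / m) atTop (𝓝 L) := by
    simpa using (tendsto_const_div_atTop_nhds_zero_nat (2 * R + C)).const_sub L
  refine tendsto_of_tendsto_of_tendsto_of_le_of_le' hE' hE ?_ ?_ <;>
  · filter_upwards [eventually_gt_atTop 0] with m hm
    have hm' : (0 : ℝ) < m := by exact_mod_cast hm
    have h1 := abs_le.1 (key m)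
    first
    | rw [le_div_iff₀ hm', sub_mul, div_mul_cancel₀ _ hm'.ne']
      linarith
    | rw [div_le_iff₀ hm', add_mul, div_mul_cancel₀ _ hm'.ne']
      linarith

/-- Two backward orbits are compared by matching a point of one with a point of the other at the
same height and by pushing this pair forward: the shift between the indices remains bounded,
since otherwise a late point of one orbit would be close to the initial point of the other. -/
lemma IsQuasiTranslation.exists_dist_le {L C : ℝ} (hQ : IsQuasiTranslation f c L C)
    (hL : 0 < L) (hc : IsRay c) (h4 : FourPoint X K) (hf : ∀ x y, dist (f x) (f y) ≤ dist x y)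
    {x y : ℕ → X} (hx : IsBackwardOrbit f x) (hxstep : HasBoundedStep x)
    (hxend : TendsToEnd c x atTop) (hy : IsBackwardOrbit f y) (hystep : HasBoundedStep y)
    (hyend : TendsToEnd c y atTop) : ∃ M : ℝ, ∀ n, dist (x n) (y n) ≤ M := by
  classical
  obtain ⟨R, hR⟩ := hQ.exists_dist_height_le hL hc h4 hf hx hxstep hxend
  obtain ⟨R', hR'⟩ := hQ.exists_dist_height_le hL hc h4 hf hy hystep hyend
  obtain ⟨S, hS⟩ := hystep
  have hS0 := dist_nonneg.trans (hS 0)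
  set M := R + R' + (S + dist (y 0) (c 0)) with hM
  have hmatch : ∀ n, ∃ j, dist (x n) (y j) ≤ M := by
    intro n
    have hex : ∃ j, dist (x n) (c 0) ≤ dist (y j) (c 0) :=
      (hyend.eventually_le_dist (dist (x n) (c 0))).exists
    have hspec := Nat.find_spec hex
    have hmin := Nat.find_min hex (m := Nat.find hex - 1)
    set j := Nat.find hex
    have hj : dist (y j) (c 0) - dist (x n) (c 0) ≤ S + dist (y 0) (c 0) := by
      rcases Nat.eq_zero_or_pos j with h0 | h0
      · rw [h0]
        linarith [dist_nonneg (x := x n) (y := c 0)]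
      · have h1 := hmin (by omega)
        have h2 := hS (j - 1)
        rw [Nat.sub_add_cancel h0] at h2
        have h3 := dist_triangle_left (y j) (c 0) (y (j - 1))
        linarith [dist_nonneg (x := y 0) (y := c 0)]
    refine ⟨j, ?_⟩
    have h1 := dist_triangle4 (x n) (c (dist (x n) (c 0))) (c (dist (y j) (c 0))) (y j)
    rw [hc _ _ dist_nonneg dist_nonneg, abs_sub_comm, abs_of_nonneg (by linarith),
      dist_comm (c (dist (y j) (c 0))) (y j)] at h1
    linarith [hR n, hR' j]
  obtain ⟨i₀, hi₀⟩ := eventually_atTop.1 (hyend.eventually_le_dist (M + dist (x 0) (c 0) + 1))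
  obtain ⟨i₁, hi₁⟩ := eventually_atTop.1 (hxend.eventually_le_dist (M + dist (y 0) (c 0) + 1))
  refine ⟨M + (i₀ + i₁) * S, fun n => ?_⟩
  obtain ⟨j, hj⟩ := hmatch n
  have hshift : dist (y j) (y n) ≤ (i₀ + i₁) * S := by
    rcases le_total n j with h | h
    · obtain ⟨i, rfl⟩ := Nat.exists_eq_add_of_le' h
      have h1 := dist_iterate_le hf n (x (0 + n)) (y (i + n))
      rw [hx.iterate_apply, hy.iterate_apply, zero_add] at h1
      have hi : i ≤ i₀ := by
        by_contra! hlt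
        have h2 := hi₀ i hlt.le
        have h3 := dist_triangle_left (y i) (c 0) (x 0)
        linarith
      have h2 : (i : ℝ) ≤ i₀ + i₁ := by exact_mod_cast (by omega : i ≤ i₀ + i₁)
      rw [dist_comm, add_comm i n]
      exact (dist_add_le_of_step hS n i).trans (mul_le_mul_of_nonneg_right h2 hS0)
    · obtain ⟨i, rfl⟩ := Nat.exists_eq_add_of_le' h
      have h1 := dist_iterate_le hf j (x (i + j)) (y (0 + j))
      rw [hx.iterate_apply, hy.iterate_apply, zero_add] at h1
      have hi : i ≤ i₁ := by
        by_contra! hlt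
        have h2 := hi₁ i hlt.le
        have h3 := dist_triangle (x i) (y 0) (c 0)
        linarith
      have h2 : (i : ℝ) ≤ i₀ + i₁ := by exact_mod_cast (by omega : i ≤ i₀ + i₁)
      rw [add_comm i j]
      exact (dist_add_le_of_step hS j i).trans (mul_le_mul_of_nonneg_right h2 hS0)
  exact (dist_triangle _ _ _).trans (add_le_add hj hshift)

end BackwardOrbit

theorem theorem4p2 {X : Type*} [MetricSpace X] [ProperSpace X]
    (hgeo : IsGeodesicSpace X) (hhyp : IsGromovHyperbolic X)
    (f : X → X) (hf : LipschitzWith 1 f)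
    (η : GromovBoundary X) (hη : IsBRFP f η)
    (p : X) (hrep : 0 < logStableDilation f η p) :
    ∃ L : ℝ,
      -- the stable dilation is well defined, with `log Λ_η = L`
      (∀ q : X, logStableDilation f η q = (L : EReal) ∧
        Tendsto (fun n : ℕ => logDilation f^[n] η q / (n : EReal)) atTop (𝓝 (L : EReal))) ∧
      -- (i)
      (∃ x : ℕ → X, IsBackwardOrbit f x ∧ HasBoundedStep x ∧ Tendsto x atTop η.nhds ∧
        HasBackwardStepRate x L) ∧
      -- (ii)
      (∀ x y : ℕ → X, IsBackwardOrbit f x → HasBoundedStep x → Tendsto x atTop η.nhds →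
        IsBackwardOrbit f y → HasBoundedStep y → Tendsto y atTop η.nhds →
          ∃ M : ℝ, ∀ n, dist (x n) (y n) ≤ M) ∧
      -- (iii)
      (∀ y : ℕ → X, IsBackwardOrbit f y → HasBoundedStep y → Tendsto y atTop η.nhds →
        HasBackwardStepRate y L) := by
  obtain ⟨γ, rfl⟩ : ∃ γ : GeodesicRay X, γ.endpoint = η := Quotient.exists_rep η
  obtain ⟨δ, hδ, hyp⟩ := hhyp
  have h4 := hyp.fourPoint hδ hgeo
  have hf' : ∀ x y, dist (f x) (f y) ≤ dist x y := fun x y => by simpa using hf.dist_le_mul x y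
  obtain ⟨D, hD⟩ := hη.exists_dist_map_le γ h4 hf'
  obtain ⟨L, C, hL, hQ⟩ := γ.isRay.exists_isQuasiTranslation h4 hf' hD
  have hlim := γ.tendsto_logDilation_div h4 hf' hD hL
  have hstable : ∀ q, logStableDilation f γ.endpoint q = (L : EReal) := fun q =>
    (hlim q).limsup_eq
  rw [hstable p] at hrep
  have hL0 : 0 < L := by exact_mod_cast hrep
  simp only [γ.tendsto_nhds_iff]
  refine ⟨L, fun q => ⟨hstable q, hlim q⟩, ?_, ?_, ?_⟩
  · obtain ⟨x, hx, hxstep, hxend⟩ := hQ.exists_backwardOrbit hL0 γ.isRay h4 hf' hD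
    exact ⟨x, hx, hxstep, hxend, hQ.hasBackwardStepRate hL0 γ.isRay h4 hf' hx hxstep hxend⟩
  · intro x y hx hxstep hxend hy hystep hyend
    exact hQ.exists_dist_le hL0 γ.isRay h4 hf' hx hxstep hxend hy hystep hyend
  · intro y hy hystep hyend
    exact hQ.hasBackwardStepRate hL0 γ.isRay h4 hf' hy hystep hyend
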